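/- For a nonnegative integer $n$, let $A_1(n)$ denote the number of partitions of $n$ such that, if $2j$ is the largest even part that appears at least twice (with $j=0$ if no even part is repeated), then every positive even integer less than $2j$ also appears at least twice, no odd part less than $2j+2$ appears, and no part greater than $2j$ is repeated. Let $C_{3,1}(n)$ denote the number of partitions of $n$ into parts $\not\equiv 0,\pm 1 \pmod 7$. Then $A_1(n)=C_{3,1}(n)$ for all integers $n\ge 0$. -/

import Mathlib

/-- The multiplicity of `a` as a part of the partition `p`. -/
def partMult {n : ℕ} (p : n.Partition) (a : ℕ) : ℕ := p.parts.count a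

/-- The largest even part of `p` that appears at least twice; it is `0` if there is none. -/
def largestRepeatedEven {n : ℕ} (p : n.Partition) : ℕ :=
  (p.parts.toFinset.filter fun a => Even a ∧ 2 ≤ partMult p a).sup id

/-- The condition defining the partitions counted by `A₁`, where `2j` is the largest repeated
even part (`j = 0` if no even part is repeated): every positive even integer less than `2j`
appears at least twice, no odd part is less than `2j + 2`, and no part greater than `2j` is
repeated. -/
def IsA1 {n : ℕ} (p : n.Partition) : Prop :=
  (∀ a < largestRepeatedEven p, 0 < a → Even a → 2 ≤ partMult p a) ∧
  (∀ a ∈ p.parts, Odd a → ¬ a < largestRepeatedEven p + 2) ∧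
  (∀ a ∈ p.parts, largestRepeatedEven p < a → ¬ 2 ≤ partMult p a)

instance {n : ℕ} : DecidablePred (IsA1 (n := n)) := fun p => by
  unfold IsA1; infer_instance

/-- `countA₁ n` is `A₁(n)`, the number of partitions of `n` satisfying `IsA1`. -/
def countA₁ (n : ℕ) : ℕ := (Finset.univ.filter fun p : n.Partition => IsA1 p).card

/-- `countC k i n` is `C_{k,i}(n)`, the number of partitions of `n` into parts that are not congruent to
`0`, `i` or `-i` modulo `2k + 1`. -/
def countC (k i n : ℕ) : ℕ :=
  (Finset.univ.filter fun p : n.Partition => ∀ a ∈ p.parts,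
    ¬ (a : ℤ) ≡ 0 [ZMOD 2 * k + 1] ∧
    ¬ (a : ℤ) ≡ i [ZMOD 2 * k + 1] ∧
    ¬ (a : ℤ) ≡ -i [ZMOD 2 * k + 1]).card

/-! Multiplicity conditions fix, part by part, a factor of a generating function. Split `A₁` by the
value `2j` of the largest repeated even part and multiply by the Euler product `(q;q)_∞`. With `Q =
q²`, the `j`-th term becomes `Q^(j²+j) (q;q²)_{j+1} (Q;Q)_∞ / (Q;Q)_{2j+1}`, while the generating
function of `C_{3,1}` becomes `∏ (1-q^(7k+1))(1-q^(7k+6))(1-q^(7k+7))`. Equating the two is a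
Rogers–Selberg identity, proved by Bailey's method.

`thetaSum_pentagonal` expands `(q;q²)_{j+1}` as a signed sum over `r` of `q^((3r²+r)/2)` times
`[2j+1 choose j-r]` in base `Q`. Interchanging sums, `sum_bailey` evaluates the sum over `j` as
`Q^(r²+r)`; this is Cauchy's Durfee rectangle identity. What remains is `∑ (-1)^r q^((7r²+5r)/2)`, a
product by the Jacobi triple product (`theta_eq_prod`, a limit of `thetaSum_seven`).

Everything is done modulo `X^N`: there `q` is nilpotent, so infinite sums and products are finite
and each `1 - q^i` with `i > 0` is a unit. -/

/-! ### Gaussian binomials and the finite Durfee rectangle identity. -/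

/-- The Gaussian binomial coefficient `[n choose k]` evaluated at `Q`, with an integer lower
index, equal to zero outside `0 ≤ k ≤ n`. -/
def gaussBinom {R : Type*} [CommRing R] (Q : R) : ℕ → ℤ → R
  | 0, k => if k = 0 then 1 else 0
  | n + 1, k => gaussBinom Q n k + Q ^ (n + 1 - k).toNat * gaussBinom Q n (k - 1)

/-- The `q`-Pochhammer symbol `(Q; Q)_n`. -/
def qPoch {R : Type*} [CommRing R] (Q : R) (n : ℕ) : R := ∏ i ∈ Finset.range n, (1 - Q ^ (i + 1))

section Gauss

variable {R : Type*} [CommRing R]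

lemma gaussBinom_succ (Q : R) (n : ℕ) (k : ℤ) :
    gaussBinom Q (n + 1) k
      = gaussBinom Q n k + Q ^ (n + 1 - k).toNat * gaussBinom Q n (k - 1) := rfl

lemma gaussBinom_of_neg (Q : R) (n : ℕ) {k : ℤ} (hk : k < 0) : gaussBinom Q n k = 0 := by
  induction n generalizing k with
  | zero => simp [gaussBinom, hk.ne]
  | succ n ih => rw [gaussBinom_succ, ih hk, ih (by omega)]; simp

lemma gaussBinom_of_lt (Q : R) (n : ℕ) {k : ℤ} (hk : n < k) : gaussBinom Q n k = 0 := by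
  induction n generalizing k with
  | zero => simp [gaussBinom, (show k ≠ 0 by push_cast at hk; omega)]
  | succ n ih =>
    push_cast at hk
    rw [gaussBinom_succ, ih (by omega), ih (by omega)]; simp

lemma gaussBinom_zero_right (Q : R) (n : ℕ) : gaussBinom Q n 0 = 1 := by
  induction n with
  | zero => simp [gaussBinom]
  | succ n ih => rw [gaussBinom_succ, ih, gaussBinom_of_neg Q n (by omega)]; simp

/-- A product vanishing outside the range of the Gaussian binomial only depends on the values of
the other factor inside this range. -/
lemma mul_gaussBinom_congr (Q : R) (n : ℕ) (k : ℤ) {a b : R}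
    (h : 0 ≤ k → k ≤ n → a = b) : a * gaussBinom Q n k = b * gaussBinom Q n k := by
  rcases lt_or_ge k 0 with h0 | h0
  · simp [gaussBinom_of_neg Q n h0]
  rcases lt_or_ge (n : ℤ) k with h1 | h1
  · simp [gaussBinom_of_lt Q n h1]
  rw [h h0 h1]

lemma gaussBinom_succ' (Q : R) (n : ℕ) (k : ℤ) :
    gaussBinom Q (n + 1) k = Q ^ k.toNat * gaussBinom Q n k + gaussBinom Q n (k - 1) := by
  induction n generalizing k with
  | zero =>
    rw [gaussBinom_succ]
    have h1 : Q ^ k.toNat * gaussBinom Q 0 k = 1 * gaussBinom Q 0 k :=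
      mul_gaussBinom_congr Q 0 k fun h h' => by
        rw [show k.toNat = 0 by omega, pow_zero]
    have h2 : Q ^ ((0 : ℕ) + 1 - k).toNat * gaussBinom Q 0 (k - 1)
        = 1 * gaussBinom Q 0 (k - 1) :=
      mul_gaussBinom_congr Q 0 (k - 1) fun h h' => by
        rw [show ((0 : ℕ) + 1 - k).toNat = 0 by omega, pow_zero]
    rw [h1, h2]; ring
  | succ n ih =>
    have e1 := gaussBinom_succ Q (n + 1) k
    rw [ih k, ih (k - 1)] at e1
    have e2 := gaussBinom_succ Q n k
    have e3 := gaussBinom_succ Q n (k - 1)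
    -- The two exponents have the same sum only where `toNat` does not truncate; outside this range
    -- the binomial vanishes.
    have h := mul_gaussBinom_congr Q n (k - 1)
      (a := Q ^ (((n + 1 : ℕ) : ℤ) + 1 - k).toNat * Q ^ (k - 1).toNat)
      (b := Q ^ k.toNat * Q ^ ((n : ℤ) + 1 - k).toNat) fun h h' => by
        rw [← pow_add, ← pow_add]; congr 1; omega
    rw [e1, e2, e3,
      show (n : ℤ) + 1 - (k - 1) = ((n + 1 : ℕ) : ℤ) + 1 - k by push_cast; ring]
    linear_combination h

lemma gaussBinom_symm (Q : R) (n : ℕ) (k : ℤ) : gaussBinom Q n k = gaussBinom Q n (n - k) := by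
  induction n generalizing k with
  | zero => simp [gaussBinom]
  | succ n ih =>
    rw [gaussBinom_succ, gaussBinom_succ', ih k, ih (k - 1)]
    push_cast
    rw [show (n : ℤ) - (k - 1) = n + 1 - k by ring, show (n : ℤ) + 1 - k - 1 = n - k by ring]
    ring

lemma qPoch_succ (Q : R) (n : ℕ) : qPoch Q (n + 1) = qPoch Q n * (1 - Q ^ (n + 1)) :=
  Finset.prod_range_succ _ _

lemma gaussBinom_self (Q : R) (n : ℕ) : gaussBinom Q n n = 1 := by
  rw [gaussBinom_symm, sub_self, gaussBinom_zero_right]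

lemma gaussBinom_mul_qPoch (Q : R) (a b : ℕ) :
    gaussBinom Q (a + b) a * (qPoch Q a * qPoch Q b) = qPoch Q (a + b) := by
  induction h : a + b generalizing a b with
  | zero =>
    obtain ⟨rfl, rfl⟩ : a = 0 ∧ b = 0 := by omega
    simp [gaussBinom, qPoch]
  | succ n ih =>
    rcases a with _ | a
    · obtain rfl : b = n + 1 := by omega
      rw [Nat.cast_zero, gaussBinom_zero_right]; simp [qPoch]
    rcases b with _ | b
    · obtain rfl : a = n := by omega
      rw [gaussBinom_self]; simp [qPoch]
    have h1 := ih (a + 1) b (by omega)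
    have h2 := ih a (b + 1) (by omega)
    rw [gaussBinom_succ, qPoch_succ Q n, qPoch_succ Q b]
    rw [qPoch_succ Q b] at h2
    rw [show ((n : ℤ) + 1 - ((a + 1 : ℕ) : ℤ)).toNat = b + 1 by omega,
      show (((a + 1 : ℕ) : ℤ) - 1) = (a : ℤ) by push_cast; ring]
    have h3 : Q ^ (n + 1) = Q ^ (a + 1) * Q ^ (b + 1) := by
      rw [← pow_add]; congr 1; omega
    rw [h3]
    have h4 := qPoch_succ Q a
    linear_combination (1 - Q ^ (b + 1)) * h1 + Q ^ (b + 1) * (1 - Q ^ (a + 1)) * h2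
      + Q ^ (b + 1) * gaussBinom Q n a * qPoch Q b * (1 - Q ^ (b + 1)) * h4

/-- A finite form of Cauchy's Durfee rectangle identity. -/
lemma sum_durfee_rectangle (Q : R) (K L : ℕ) :
    ∑ m ∈ Finset.range (K + 1), Q ^ (m * (m + L)) * gaussBinom Q K m *
      ∏ i ∈ Finset.Ico (m + L + 1) (K + L + 1), (1 - Q ^ i) = 1 := by
  induction K generalizing L with
  | zero => simp [gaussBinom]
  | succ K ih =>
    -- Pascal's rule splits the sum in two. The first half is the case `K, L` times one new factor,
    -- the second is the case `K, L + 1` times `Q^(K+L+1)`.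
    have h1 : ∑ m ∈ Finset.range (K + 2), Q ^ (m * (m + L)) * gaussBinom Q K m *
        ∏ i ∈ Finset.Ico (m + L + 1) (K + 1 + L + 1), (1 - Q ^ i) = 1 - Q ^ (K + L + 1) := by
      rw [Finset.sum_range_succ, gaussBinom_of_lt Q K (by push_cast; omega)]
      rw [mul_zero, zero_mul, add_zero]
      have h0 := congrArg (· * (1 - Q ^ (K + L + 1))) (ih L)
      simp only [one_mul, Finset.sum_mul] at h0
      rw [← h0]
      refine Finset.sum_congr rfl fun m hm => ?_
      rw [Finset.mem_range] at hm
      rw [show K + 1 + L + 1 = (K + L + 1) + 1 by ring, Finset.prod_Ico_succ_top (by omega)]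
      ring
    have h2 : ∑ m ∈ Finset.range (K + 2), Q ^ (m * (m + L)) *
        (Q ^ ((K : ℤ) + 1 - m).toNat * gaussBinom Q K ((m : ℤ) - 1)) *
        ∏ i ∈ Finset.Ico (m + L + 1) (K + 1 + L + 1), (1 - Q ^ i) = Q ^ (K + L + 1) := by
      rw [Finset.sum_range_succ', gaussBinom_of_neg Q K (by simp), mul_zero, mul_zero, zero_mul,
        add_zero]
      have h0 := congrArg (Q ^ (K + L + 1) * ·) (ih (L + 1))
      simp only [mul_one, Finset.mul_sum] at h0
      rw [← h0]
      refine Finset.sum_congr rfl fun m hm => ?_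
      rw [Finset.mem_range] at hm
      rw [show m + 1 + L + 1 = m + (L + 1) + 1 by ring,
        show K + 1 + L + 1 = K + (L + 1) + 1 by ring,
        show ((m + 1 : ℕ) : ℤ) - 1 = m by push_cast; ring,
        show ((K : ℤ) + 1 - ((m + 1 : ℕ) : ℤ)).toNat = K - m by omega]
      have h3 : Q ^ ((m + 1) * (m + 1 + L)) * Q ^ (K - m)
          = Q ^ (K + L + 1) * Q ^ (m * (m + (L + 1))) := by
        rw [← pow_add, ← pow_add]; congr 1
        obtain ⟨d, rfl⟩ := Nat.exists_eq_add_of_le (show m ≤ K by omega)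
        rw [Nat.add_sub_cancel_left]; ring
      linear_combination (gaussBinom Q K m *
        ∏ i ∈ Finset.Ico (m + (L + 1) + 1) (K + (L + 1) + 1), (1 - Q ^ i)) * h3
    refine Eq.trans ?_ (sub_add_cancel (1 : R) (Q ^ (K + L + 1)))
    conv_rhs => rw [← h1, ← h2, ← Finset.sum_add_distrib]
    refine Finset.sum_congr rfl fun m _ => ?_
    rw [gaussBinom_succ]; ring

/-! ### Finite theta sums and their recurrences. -/

/-- The signed sum `∑ (-1)^r q^(e r) [N choose c - r]` over all integers `r`. -/
noncomputable def thetaSum (q Q : R) (e : ℤ → ℕ) (N : ℕ) (c : ℤ) : R :=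
  ∑ᶠ r : ℤ, ((r.negOnePow : ℤ) : R) * q ^ e r * gaussBinom Q N (c - r)

lemma support_mul_gaussBinom_subset (Q : R) (f : ℤ → R) (N : ℕ) (c : ℤ) :
    (Function.support fun r : ℤ => f r * gaussBinom Q N (c - r)) ⊆ Finset.Icc (c - N) c := by
  intro r hr
  rw [Finset.coe_Icc, Set.mem_Icc]
  by_contra h
  refine hr ?_
  rcases lt_or_ge (c - r) 0 with h0 | h0
  · simp [gaussBinom_of_neg Q N h0]
  · simp [gaussBinom_of_lt Q N (show (N : ℤ) < c - r by omega)]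

lemma finite_support_mul_gaussBinom (Q : R) (f : ℤ → R) (N : ℕ) (c : ℤ) :
    (Function.support fun r : ℤ => f r * gaussBinom Q N (c - r)).Finite :=
  (Finset.finite_toSet _).subset (support_mul_gaussBinom_subset Q f N c)

lemma thetaSum_eq_sum (q Q : R) (e : ℤ → ℕ) (N : ℕ) (c : ℤ) {s : Finset ℤ}
    (hs : Finset.Icc (c - N) c ⊆ s) :
    thetaSum q Q e N c
      = ∑ r ∈ s, ((r.negOnePow : ℤ) : R) * q ^ e r * gaussBinom Q N (c - r) :=
  finsum_eq_sum_of_support_subset _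
    ((support_mul_gaussBinom_subset Q _ N c).trans (Finset.coe_subset.2 hs))

lemma thetaSum_zero (q Q : R) (e : ℤ → ℕ) (he : e 0 = 0) : thetaSum q Q e 0 0 = 1 := by
  rw [thetaSum_eq_sum q Q e 0 0 (s := {0}) (by simp)]
  simp [he, gaussBinom]

/-- Pascal's rule, then the shift `r ↦ r - 1` in the second sum, which realigns the binomials and
flips the sign. The hypothesis says that the shifted exponent is again of the form `e' r + t`. -/
lemma thetaSum_succ (q : R) (d N t : ℕ) (c : ℤ) (e e' : ℤ → ℕ)
    (h : ∀ r : ℤ, 0 ≤ c - r → c - r ≤ N →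
      (e (r - 1) : ℤ) + d * (N + 1 - (c - (r - 1))) = e' r + t) :
    thetaSum q (q ^ d) e (N + 1) c
      = thetaSum q (q ^ d) e N c - q ^ t * thetaSum q (q ^ d) e' N c := by
  have h1 : thetaSum q (q ^ d) e (N + 1) c = thetaSum q (q ^ d) e N c +
      ∑ᶠ r : ℤ, ((r.negOnePow : ℤ) : R) * q ^ e r * (q ^ d) ^ (N + 1 - (c - r)).toNat *
        gaussBinom (q ^ d) N (c - 1 - r) := by
    rw [thetaSum, thetaSum, ← finsum_add_distrib (finite_support_mul_gaussBinom _ _ _ _)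
      (finite_support_mul_gaussBinom _ _ _ _)]
    refine finsum_congr fun r => ?_
    rw [gaussBinom_succ, show c - r - 1 = c - 1 - r by ring]; ring
  have h5 : -(q ^ t * thetaSum q (q ^ d) e' N c) = ∑ᶠ r : ℤ, -q ^ t *
      (((r.negOnePow : ℤ) : R) * q ^ e' r * gaussBinom (q ^ d) N (c - r)) := by
    rw [← neg_mul]
    exact mul_finsum' _ _ (finite_support_mul_gaussBinom (q ^ d) _ N c)
  rw [h1, sub_eq_add_neg (thetaSum q _ e N c), h5, ← finsum_comp_equiv (Equiv.subRight (1 : ℤ))]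
  congr 1
  refine finsum_congr fun r => ?_
  simp only [Equiv.subRight_apply]
  rw [show c - 1 - (r - 1) = c - r by ring, ← mul_assoc]
  refine mul_gaussBinom_congr _ _ _ fun h0 h2 => ?_
  have h3 := h r h0 h2
  have h4 : e (r - 1) + d * (N + 1 - (c - (r - 1))).toNat = e' r + t := by
    zify
    rw [Int.toNat_of_nonneg (by omega)]
    exact h3
  rw [← pow_mul, mul_assoc, ← pow_add, h4, Int.negOnePow_sub, Int.negOnePow_one, pow_add]
  push_cast
  ring

/-- The same argument with the other Pascal rule and the shift `r ↦ r + 1`. -/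
lemma thetaSum_succ' (q : R) (d N t : ℕ) (c : ℤ) (e e' : ℤ → ℕ)
    (h : ∀ r : ℤ, 0 ≤ c - r → c - r ≤ N →
      (e (r + 1) : ℤ) + d * (c - r) = e' r + t) :
    thetaSum q (q ^ d) e (N + 1) (c + 1)
      = thetaSum q (q ^ d) e N c - q ^ t * thetaSum q (q ^ d) e' N c := by
  have h1 : thetaSum q (q ^ d) e (N + 1) (c + 1) = thetaSum q (q ^ d) e N c +
      ∑ᶠ r : ℤ, ((r.negOnePow : ℤ) : R) * q ^ e r * (q ^ d) ^ (c + 1 - r).toNat *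
        gaussBinom (q ^ d) N (c + 1 - r) := by
    rw [thetaSum, thetaSum, ← finsum_add_distrib (finite_support_mul_gaussBinom _ _ _ _)
      (finite_support_mul_gaussBinom _ _ _ _)]
    refine finsum_congr fun r => ?_
    rw [gaussBinom_succ', show c + 1 - r - 1 = c - r by ring]; ring
  have h5 : -(q ^ t * thetaSum q (q ^ d) e' N c) = ∑ᶠ r : ℤ, -q ^ t *
      (((r.negOnePow : ℤ) : R) * q ^ e' r * gaussBinom (q ^ d) N (c - r)) := by
    rw [← neg_mul]
    exact mul_finsum' _ _ (finite_support_mul_gaussBinom (q ^ d) _ N c)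
  rw [h1, sub_eq_add_neg (thetaSum q _ e N c), h5, ← finsum_comp_equiv (Equiv.addRight (1 : ℤ))]
  congr 1
  refine finsum_congr fun r => ?_
  simp only [Equiv.coe_addRight]
  rw [show c + 1 - (r + 1) = c - r by ring, ← mul_assoc]
  refine mul_gaussBinom_congr _ _ _ fun h0 h2 => ?_
  have h3 := h r h0 h2
  have h4 : e (r + 1) + d * (c - r).toNat = e' r + t := by
    zify
    rw [Int.toNat_of_nonneg (by omega)]
    exact h3
  rw [← pow_mul, mul_assoc, ← pow_add, h4, Int.negOnePow_succ, pow_add]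
  push_cast
  ring

lemma thetaSum_neg (q Q : R) (n : ℕ) (e e' : ℤ → ℕ) (h : ∀ r, e (-r) = e' r) :
    thetaSum q Q e (2 * n) n = thetaSum q Q e' (2 * n) n := by
  rw [thetaSum, ← finsum_comp_equiv (Equiv.neg ℤ), thetaSum]
  refine finsum_congr fun r => ?_
  rw [Equiv.neg_apply, h, Int.negOnePow_neg, gaussBinom_symm]
  congr 2
  push_cast; ring

/-- The involution `r ↦ -1 - r` preserves the exponent and the binomial but reverses the sign, so
terms cancel in pairs. -/
lemma thetaSum_eq_zero (q Q : R) (n : ℕ) (e : ℤ → ℕ) (h : ∀ r, e (-1 - r) = e r) :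
    thetaSum q Q e (2 * n + 1) n = 0 := by
  rw [thetaSum_eq_sum q Q e _ _ (s := Finset.Icc (-n - 1 : ℤ) n)
    (Finset.Icc_subset_Icc (by push_cast; omega) le_rfl)]
  refine Finset.sum_involution (fun r _ => -1 - r) (fun r _ => ?_) (fun r _ _ => by omega)
    (fun r hr => by rw [Finset.mem_Icc] at *; omega) (fun r _ => by ring)
  rw [h, gaussBinom_symm Q _ (n - (-1 - r)), Int.negOnePow_sub, Int.negOnePow_neg,
    Int.negOnePow_one,
    show ((2 * n + 1 : ℕ) : ℤ) - (n - (-1 - r)) = n - r by push_cast; ring]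
  push_cast
  ring

/-! ### Quadratic exponents and closed forms of the finite theta sums. -/

/-- The exponent `(a r² + b r) / 2`. -/
def quadExp (a b : ℤ) (r : ℤ) : ℕ := ((a * r ^ 2 + b * r) / 2).toNat

/-- Justifies both the halving and the `toNat`: the parity condition makes the numerator even, and
`|b| ≤ a` makes it nonnegative. Exponent identities thereby become linear arithmetic. -/
lemma two_mul_quadExp {a b : ℤ} (h : Even (a + b)) (hb : |b| ≤ a) (r : ℤ) :
    2 * (quadExp a b r : ℤ) = a * r ^ 2 + b * r := by
  have h2 : Even (a * r ^ 2 + b * r) := by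
    rcases Int.even_or_odd r with hr | hr <;> rcases Int.even_or_odd a with ha | ha <;>
      simp_all [parity_simps]
  have h0 : 0 ≤ a * r ^ 2 + b * r := by
    have h1 : |b * r| ≤ a * r ^ 2 := by
      rw [abs_mul, ← sq_abs r, sq, ← mul_assoc]
      have : |r| ≤ |r| * |r| := by
        rcases eq_or_ne r 0 with rfl | hr
        · simp
        · nlinarith [Int.one_le_abs hr]
      nlinarith [abs_nonneg b, abs_nonneg r, mul_le_mul_of_nonneg_right hb (abs_nonneg r)]
    linarith [neg_abs_le (b * r)]
  rw [quadExp, Int.toNat_of_nonneg (by omega)]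
  exact Int.two_mul_ediv_two_of_even h2

/-- A finite form of the Rogers–Selberg Bailey pair. -/
theorem thetaSum_pentagonal (q : R) (n : ℕ) :
    thetaSum q (q ^ 2) (quadExp 3 1) (2 * n + 1) n
      = ∏ k ∈ Finset.range (n + 1), (1 - q ^ (2 * k + 1)) := by
  have e1 := two_mul_quadExp (a := 3) (b := 1) (by decide) (by decide)
  have e2 := two_mul_quadExp (a := 3) (b := -1) (by decide) (by decide)
  have e3 := two_mul_quadExp (a := 3) (b := 3) (by decide) (by decide)
  -- The recurrence produces the exponent `(3r² - r)/2`; the reflection `r ↦ -r` of the central sum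
  -- turns it back into `(3r² + r)/2`.
  have odd_step : ∀ n : ℕ, thetaSum q (q ^ 2) (quadExp 3 1) (2 * n + 1) n
      = thetaSum q (q ^ 2) (quadExp 3 1) (2 * n) n * (1 - q ^ (2 * n + 1)) := fun n => by
    rw [thetaSum_succ q 2 (2 * n) (2 * n + 1) n (quadExp 3 1) (quadExp 3 (-1)),
      ← thetaSum_neg q (q ^ 2) n (quadExp 3 1) (quadExp 3 (-1))]
    · ring
    · intro r; unfold quadExp; congr 2; ring
    · intro r _ _
      have := e1 (r - 1); have := e2 r
      push_cast; linarith
  induction n with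
  | zero =>
    rw [odd_step, Nat.mul_zero, Nat.cast_zero, thetaSum_zero _ _ _ (by decide)]; simp
  | succ n ih =>
    -- Here the correction term has exponent `3(r² + r)/2`, invariant under `r ↦ -1 - r`, so it
    -- vanishes.
    rw [odd_step, Finset.prod_range_succ, ← ih, Nat.cast_succ,
      show 2 * (n + 1) = 2 * n + 1 + 1 by ring,
      thetaSum_succ' q 2 (2 * n + 1) (2 * n + 2) n (quadExp 3 1) (quadExp 3 3),
      thetaSum_eq_zero q _ n (quadExp 3 3), mul_zero, sub_zero]
    · intro r; unfold quadExp; congr 2; ring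
    · intro r _ _
      have := e1 (r + 1); have := e3 r
      push_cast; linarith

/-- A finite form of the Jacobi triple product modulo seven. -/
theorem thetaSum_seven (q : R) (n : ℕ) :
    thetaSum q (q ^ 7) (quadExp 7 5) (2 * n + 1) n
      = (∏ k ∈ Finset.range n, (1 - q ^ (7 * k + 1)) * (1 - q ^ (7 * k + 6))) *
        (1 - q ^ (7 * n + 1)) := by
  have e1 := two_mul_quadExp (a := 7) (b := 5) (by decide) (by decide)
  -- Unlike in the pentagonal case, both recurrences reproduce the same exponent, so each
  -- contributes one factor.
  have odd_step : ∀ n : ℕ, thetaSum q (q ^ 7) (quadExp 7 5) (2 * n + 1) n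
      = thetaSum q (q ^ 7) (quadExp 7 5) (2 * n) n * (1 - q ^ (7 * n + 1)) := fun n => by
    rw [thetaSum_succ q 7 (2 * n) (7 * n + 1) n (quadExp 7 5) (quadExp 7 5)]
    · ring
    · intro r _ _
      have := e1 (r - 1); have := e1 r
      push_cast; linarith
  induction n with
  | zero =>
    rw [odd_step, Nat.mul_zero, Nat.cast_zero, thetaSum_zero _ _ _ (by decide)]; simp
  | succ n ih =>
    rw [odd_step, Finset.prod_range_succ, Nat.cast_succ,
      show 2 * (n + 1) = 2 * n + 1 + 1 by ring,
      thetaSum_succ' q 7 (2 * n + 1) (7 * n + 6) n (quadExp 7 5) (quadExp 7 5), ih]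
    · ring
    · intro r _ _
      have := e1 (r + 1); have := e1 r
      push_cast; linarith

end Gauss

/-! ### Limiting forms with nilpotent `q`: Bailey's lemma and the triple product. -/

section Nilpotent

variable {R : Type*} [CommRing R]

lemma isUnit_one_sub_pow {q : R} (hq : IsNilpotent q) {i : ℕ} (hi : i ≠ 0) :
    IsUnit (1 - q ^ i) :=
  (hq.pow_of_pos hi).isUnit_one_sub

lemma isUnit_qPoch {Q : R} (hQ : IsNilpotent Q) (n : ℕ) : IsUnit (qPoch Q n) :=
  Finset.prod_induction _ _ (fun _ _ => IsUnit.mul) isUnit_one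
    fun _ _ => isUnit_one_sub_pow hQ (Nat.succ_ne_zero _)

/-- All later factors equal `1`, so `qPoch Q N` plays the role of `(Q;Q)_∞`. -/
lemma qPoch_eq_of_le {Q : R} {N M : ℕ} (hQ : Q ^ N = 0) (h : N ≤ M) :
    qPoch Q M = qPoch Q N := by
  refine (Finset.prod_subset (Finset.range_subset_range.2 h) fun i _ hi => ?_).symm
  rw [Finset.mem_range, not_lt] at hi
  rw [pow_eq_zero_of_le (by omega) hQ, sub_zero]

lemma qPoch_mul_prod_Ico (Q : R) {a b : ℕ} (h : a ≤ b) :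
    qPoch Q a * ∏ i ∈ Finset.Ico (a + 1) (b + 1), (1 - Q ^ i) = qPoch Q b := by
  have h1 : ∀ n, qPoch Q n = ∏ i ∈ Finset.Ico 1 (n + 1), (1 - Q ^ i) := fun n => by
    rw [Finset.prod_Ico_eq_prod_range, Nat.add_sub_cancel]
    exact Finset.prod_congr rfl fun i _ => by rw [add_comm]
  rw [h1, h1, Finset.prod_Ico_consecutive _ (by omega) (by omega)]

/-- The inverse of `(Q; Q)_n`. -/
noncomputable def qPochInv (Q : R) (n : ℕ) : R := Ring.inverse (qPoch Q n)

lemma qPoch_mul_qPochInv {Q : R} (hQ : IsNilpotent Q) (n : ℕ) :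
    qPoch Q n * qPochInv Q n = 1 :=
  Ring.mul_inverse_cancel _ (isUnit_qPoch hQ n)

lemma gaussBinom_eq_mul_qPochInv {Q : R} (hQ : IsNilpotent Q) (a b : ℕ) :
    gaussBinom Q (a + b) a = qPoch Q (a + b) * qPochInv Q a * qPochInv Q b := by
  have h1 := qPoch_mul_qPochInv hQ a
  have h2 := qPoch_mul_qPochInv hQ b
  rw [← gaussBinom_mul_qPoch]
  linear_combination (-(gaussBinom Q (a + b) a) * qPoch Q b * qPochInv Q b) * h1
    - gaussBinom Q (a + b) a * h2

/-- Cauchy's Durfee rectangle identity. -/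
lemma sum_durfee_rectangle_qPochInv {Q : R} {N : ℕ} (hQ : Q ^ N = 0) (L : ℕ) :
    ∑ m ∈ Finset.range N, Q ^ (m * (m + L)) * qPochInv Q m * qPochInv Q (m + L) * qPoch Q N
      = 1 := by
  have hQ' : IsNilpotent Q := ⟨N, hQ⟩
  -- With `K = 2N`, each surviving index `m < N` has `2N - m ≥ N`, so `[2N choose m]` is already its
  -- limit `1/(Q;Q)_m`.
  rw [← sum_durfee_rectangle Q (2 * N) L]
  refine Finset.sum_subset_zero_on_sdiff (Finset.range_subset_range.2 (by omega))
    (fun m hm => ?_) fun m hm => ?_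
  · rw [Finset.mem_sdiff, Finset.mem_range, Finset.mem_range, not_lt] at hm
    rw [pow_eq_zero_of_le ((hm.2.trans (Nat.le_mul_self m)).trans
      (Nat.mul_le_mul_left m (Nat.le_add_right m L))) hQ]; ring
  · rw [Finset.mem_range] at hm
    have h1 := gaussBinom_eq_mul_qPochInv hQ' m (2 * N - m)
    rw [qPochInv, qPochInv, qPoch_eq_of_le hQ (show N ≤ 2 * N - m by omega),
      Nat.add_sub_cancel' (by omega), qPoch_eq_of_le hQ (show N ≤ 2 * N by omega),
      ← qPochInv, ← qPochInv] at h1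
    have h2 := qPoch_mul_prod_Ico Q (show m + L ≤ 2 * N + L by omega)
    rw [qPoch_eq_of_le hQ (show N ≤ 2 * N + L by omega)] at h2
    have h3 := qPoch_mul_qPochInv hQ' N
    have h4 := qPoch_mul_qPochInv hQ' (m + L)
    rw [h1, ← h2]
    rw [← h2] at h3
    generalize ∏ i ∈ Finset.Ico (m + L + 1) (2 * N + L + 1), (1 - Q ^ i) = Z at *
    linear_combination Q ^ (m * (m + L)) * qPochInv Q m * Z * (h4 - h3)

/-- Put `n = r + m`: the exponent is `r² + r + m(m + 2r + 1)` and the binomial over `(Q;Q)_{2n+1}`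
is `1/((Q;Q)_m (Q;Q)_{m+2r+1})`, so this is the Durfee identity with `L = 2r + 1`. -/
lemma sum_bailey_nat {Q : R} {N : ℕ} (hQ : Q ^ N = 0) (r : ℕ) :
    ∑ n ∈ Finset.range N, Q ^ (n ^ 2 + n) * gaussBinom Q (2 * n + 1) (n - r) *
      qPochInv Q (2 * n + 1) * qPoch Q N = Q ^ (r ^ 2 + r) := by
  have hQ' : IsNilpotent Q := ⟨N, hQ⟩
  have h1 : ∑ n ∈ Finset.range N, Q ^ (n ^ 2 + n) * gaussBinom Q (2 * n + 1) (n - r) *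
      qPochInv Q (2 * n + 1) * qPoch Q N = ∑ n ∈ Finset.range (r + N), Q ^ (n ^ 2 + n) *
        gaussBinom Q (2 * n + 1) (n - r) * qPochInv Q (2 * n + 1) * qPoch Q N := by
    refine Finset.sum_subset (Finset.range_subset_range.2 (by omega)) fun n _ hn => ?_
    rw [Finset.mem_range, not_lt] at hn
    rw [pow_eq_zero_of_le (show N ≤ n ^ 2 + n by nlinarith) hQ]; ring
  rw [h1, Finset.sum_range_add, Finset.sum_eq_zero, zero_add, ← mul_one (Q ^ (r ^ 2 + r)),
    ← sum_durfee_rectangle_qPochInv hQ (2 * r + 1), Finset.mul_sum]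
  · refine Finset.sum_congr rfl fun m _ => ?_
    have h2 := gaussBinom_eq_mul_qPochInv hQ' m (m + (2 * r + 1))
    rw [show m + (m + (2 * r + 1)) = 2 * (r + m) + 1 by ring] at h2
    have h3 := qPoch_mul_qPochInv hQ' (2 * (r + m) + 1)
    rw [show ((r + m : ℕ) : ℤ) - r = m by push_cast; ring, h2]
    have h4 : Q ^ ((r + m) ^ 2 + (r + m)) = Q ^ (r ^ 2 + r) * Q ^ (m * (m + (2 * r + 1))) := by
      rw [← pow_add]; congr 1; ring
    rw [h4]
    linear_combination Q ^ (r ^ 2 + r) * Q ^ (m * (m + (2 * r + 1))) * qPochInv Q m *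
      qPochInv Q (m + (2 * r + 1)) * qPoch Q N * h3
  · intro n hn
    rw [Finset.mem_range] at hn
    rw [gaussBinom_of_neg Q _ (by omega)]; ring

lemma sum_bailey {Q : R} {N : ℕ} (hQ : Q ^ N = 0) (r : ℤ) :
    ∑ n ∈ Finset.range N, Q ^ (n ^ 2 + n) * gaussBinom Q (2 * n + 1) (n - r) *
      qPochInv Q (2 * n + 1) * qPoch Q N = Q ^ quadExp 2 2 r := by
  have e := two_mul_quadExp (a := 2) (b := 2) (by decide) (by decide) r
  rcases lt_or_ge r 0 with h | h
  · obtain ⟨s, hs⟩ := Int.eq_ofNat_of_zero_le (show 0 ≤ -1 - r by omega)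
    have h1 : quadExp 2 2 r = s ^ 2 + s := by
      zify
      rw [← hs]; linarith
    rw [h1, ← sum_bailey_nat hQ s]
    refine Finset.sum_congr rfl fun n _ => ?_
    rw [gaussBinom_symm, ← hs]
    congr 4
    push_cast; ring
  · obtain ⟨s, rfl⟩ := Int.eq_ofNat_of_zero_le h
    have h1 : quadExp 2 2 s = s ^ 2 + s := by
      zify
      linarith
    rw [h1, ← sum_bailey_nat hQ s]

/-- After expansion and interchange of sums, the exponents add up: `(3r² + r)/2 + 2(r² + r) = (7r² +
5r)/2`. -/
lemma sum_bailey_eq_theta {q : R} {N : ℕ} (hq : q ^ N = 0) :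
    ∑ n ∈ Finset.range N, (q ^ 2) ^ (n ^ 2 + n) *
      (∏ k ∈ Finset.range (n + 1), (1 - q ^ (2 * k + 1))) * qPochInv (q ^ 2) (2 * n + 1) *
      qPoch (q ^ 2) N
      = ∑ r ∈ Finset.Ico (-N : ℤ) N, ((r.negOnePow : ℤ) : R) * q ^ quadExp 7 5 r := by
  have hQ : (q ^ 2) ^ N = 0 := by rw [← pow_mul, mul_comm, pow_mul, hq, zero_pow two_ne_zero]
  have h1 : ∀ n ∈ Finset.range N, (q ^ 2) ^ (n ^ 2 + n) *
      (∏ k ∈ Finset.range (n + 1), (1 - q ^ (2 * k + 1))) * qPochInv (q ^ 2) (2 * n + 1) *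
      qPoch (q ^ 2) N = ∑ r ∈ Finset.Ico (-N : ℤ) N,
        ((r.negOnePow : ℤ) : R) * q ^ quadExp 3 1 r * ((q ^ 2) ^ (n ^ 2 + n) *
          gaussBinom (q ^ 2) (2 * n + 1) (n - r) * qPochInv (q ^ 2) (2 * n + 1) *
            qPoch (q ^ 2) N) := fun n hn => by
    rw [Finset.mem_range] at hn
    rw [← thetaSum_pentagonal, thetaSum_eq_sum q _ _ _ _ (s := Finset.Ico (-N : ℤ) N),
      Finset.mul_sum, Finset.sum_mul, Finset.sum_mul]
    · exact Finset.sum_congr rfl fun r _ => by ring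
    · intro r hr
      rw [Finset.mem_Icc] at hr
      rw [Finset.mem_Ico]
      omega
  rw [Finset.sum_congr rfl h1, Finset.sum_comm]
  refine Finset.sum_congr rfl fun r _ => ?_
  rw [← Finset.mul_sum, sum_bailey hQ, mul_assoc, ← pow_mul, ← pow_add]
  congr 2
  have e1 := two_mul_quadExp (a := 3) (b := 1) (by decide) (by decide) r
  have e2 := two_mul_quadExp (a := 2) (b := 2) (by decide) (by decide) r
  have e3 := two_mul_quadExp (a := 7) (b := 5) (by decide) (by decide) r
  zify
  linarith

/-- The Jacobi triple product modulo seven. -/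
lemma theta_eq_prod {q : R} {N : ℕ} (hq : q ^ N = 0) :
    ∑ r ∈ Finset.Ico (-N : ℤ) N, ((r.negOnePow : ℤ) : R) * q ^ quadExp 7 5 r
      = ∏ k ∈ Finset.range N,
        (1 - q ^ (7 * k + 1)) * (1 - q ^ (7 * k + 6)) * (1 - q ^ (7 * k + 7)) := by
  have hp : (q ^ 7) ^ N = 0 := by
    rw [← pow_mul, mul_comm, pow_mul, hq, zero_pow (by norm_num)]
  have hp' : IsNilpotent (q ^ 7) := ⟨N, hp⟩
  have hz : ∀ i, N ≤ i → q ^ i = 0 := fun i hi => pow_eq_zero_of_le hi hq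
  -- The index `2N` leaves room for both lower indices `2N - r` and `2N + 1 + r` to be at least `N`
  -- when `-N ≤ r < N`; then the binomial times `(q⁷;q⁷)_N` is `1`.
  have h1 := thetaSum_seven q (2 * N)
  rw [hz (7 * (2 * N) + 1) (by omega), sub_zero, mul_one] at h1
  have h2 : ∏ k ∈ Finset.range N, (1 - q ^ (7 * k + 1)) * (1 - q ^ (7 * k + 6)) =
      ∏ k ∈ Finset.range (2 * N), (1 - q ^ (7 * k + 1)) * (1 - q ^ (7 * k + 6)) := by
    refine Finset.prod_subset (Finset.range_subset_range.2 (by omega)) fun k _ hk => ?_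
    rw [Finset.mem_range, not_lt] at hk
    rw [hz _ (by omega), hz _ (by omega)]; ring
  have h3 : qPoch (q ^ 7) N = ∏ k ∈ Finset.range N, (1 - q ^ (7 * k + 7)) :=
    Finset.prod_congr rfl fun k _ => by rw [← pow_mul]; congr 2
  rw [Finset.prod_mul_distrib, h2, ← h3, ← h1,
    thetaSum_eq_sum q _ _ _ _ (s := Finset.Icc (-(2 * N : ℤ) - 1) (2 * N))
    (Finset.Icc_subset_Icc (by push_cast; omega) (by push_cast; omega)), Finset.sum_mul]
  refine Finset.sum_subset_zero_on_sdiff ?_ (fun r hr => ?_) fun r hr => ?_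
  · intro r hr
    rw [Finset.mem_Ico] at hr
    rw [Finset.mem_Icc]
    omega
  · rw [Finset.mem_sdiff, Finset.mem_Ico, Finset.mem_Icc] at hr
    have e3 := two_mul_quadExp (a := 7) (b := 5) (by decide) (by decide) r
    have h4 : N ≤ quadExp 7 5 r := by
      zify
      rcases lt_or_ge r 0 with h | h
      · nlinarith [show (N : ℤ) ≤ -r by omega]
      · nlinarith [show (N : ℤ) ≤ r by omega]
    rw [hz _ h4]; ring
  · rw [Finset.mem_Ico] at hr
    obtain ⟨a, ha⟩ := Int.eq_ofNat_of_zero_le (show 0 ≤ 2 * N - r by omega)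
    obtain ⟨b, hb⟩ := Int.eq_ofNat_of_zero_le (show 0 ≤ 2 * N + 1 + r by omega)
    have h4 := gaussBinom_mul_qPoch (q ^ 7) a b
    rw [qPoch_eq_of_le hp (show N ≤ a by omega), qPoch_eq_of_le hp (show N ≤ b by omega),
      qPoch_eq_of_le hp (show N ≤ a + b by omega), show a + b = 2 * (2 * N) + 1 by omega,
      ← ha] at h4
    have h5 := qPoch_mul_qPochInv hp' N
    push_cast
    linear_combination (-((r.negOnePow : ℤ) : R) * q ^ quadExp 7 5 r * qPochInv (q ^ 7) N) * h4
      + (-((r.negOnePow : ℤ) : R) * q ^ quadExp 7 5 r *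
        (1 - gaussBinom (q ^ 7) (2 * (2 * N) + 1) (2 * N - r) * qPoch (q ^ 7) N)) * h5

end Nilpotent

/-! ### Generating functions for prescribed multiplicities. -/

open PowerSeries in
open Classical in
/-- The power series `∑ X^(t i)`, where `t` runs over the multiplicities satisfying `c`. -/
noncomputable def multSeries (i : ℕ) (c : ℕ → Prop) : ℤ⟦X⟧ :=
  PowerSeries.mk fun m => if ∃ t, c t ∧ m = t * i then 1 else 0

/-- The number of partitions of `n` whose multiplicities are prescribed by `c` is a coefficient of
a product of power series. -/
theorem card_partition_eq_coeff_prod {n K : ℕ} (hK : n ≤ K) (c : ℕ → ℕ → Prop)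
    [DecidablePred fun p : n.Partition => ∀ i ∈ Finset.Icc 1 K, c i (p.parts.count i)] :
    ((Finset.univ.filter fun p : n.Partition =>
      ∀ i ∈ Finset.Icc 1 K, c i (p.parts.count i)).card : ℤ)
      = PowerSeries.coeff n (∏ i ∈ Finset.Icc 1 K, multSeries i (c i)) := by
  classical
  rw [PowerSeries.coeff_prod]
  simp only [multSeries, PowerSeries.coeff_mk, Finset.prod_boole, Finset.sum_boole]
  rw [Nat.cast_inj]
  -- A partition corresponds to the function sending `i` to the total `i` times its multiplicity;
  -- the inverse divides by `i`.
  refine Finset.card_bij (fun p _ => p.toFinsuppAntidiag) (fun p hp => ?_)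
    (fun p _ p' _ h => Nat.Partition.toFinsuppAntidiag_injective n h) fun g hg => ?_
  · rw [Finset.mem_filter] at hp ⊢
    refine ⟨Finset.finsuppAntidiag_mono (Finset.Icc_subset_Icc le_rfl hK) _
      p.toFinsuppAntidiag_mem_finsuppAntidiag, fun i hi => ⟨_, hp.2 i hi, rfl⟩⟩
  · rw [Finset.mem_filter, Finset.mem_finsuppAntidiag] at hg
    obtain ⟨⟨hsum, hsupp⟩, hg⟩ := hg
    have hdvd : ∀ i, i ∣ g i := fun i => by
      by_cases hi : i ∈ Finset.Icc 1 K
      · obtain ⟨t, -, ht⟩ := hg i hi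
        exact ht ▸ Dvd.intro_left t rfl
      · rw [Finsupp.notMem_support_iff.1 fun h => hi (hsupp h)]
        exact dvd_zero i
    have hpos : ∀ i, g i ≠ 0 → i ≠ 0 := fun i hi => by
      have := Finset.mem_Icc.1 (hsupp (Finsupp.mem_support_iff.2 hi))
      omega
    have hne : ∀ i, i ∈ g.support ↔ g i / i ≠ 0 := fun i => by
      rw [Finsupp.mem_support_iff, not_iff_not]
      refine ⟨fun h => by simp [h], fun h => ?_⟩
      rw [← Nat.div_mul_cancel (hdvd i), h, zero_mul]
    let p : n.Partition := Nat.Partition.mk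
      (Finsupp.mk g.support (fun i => g i / i) hne).toMultiset
      (fun {i} hi => by
        have hi' : g i ≠ 0 := by simpa using hi
        exact Nat.pos_of_ne_zero (hpos i hi'))
      (by
        rw [← hsum]
        suffices ∑ x ∈ g.support, g x / x * x = ∑ x ∈ Finset.Icc 1 K, g x by
          simpa [Finsupp.sum]
        exact Finset.sum_subset_zero_on_sdiff hsupp (by simp)
          fun x _ => Nat.div_mul_cancel (hdvd x))
    have hcount : ∀ i, p.parts.count i = g i / i := fun i => by simp [p]
    refine ⟨p, ?_, ?_⟩
    · rw [Finset.mem_filter]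
      refine ⟨Finset.mem_univ _, fun i hi => ?_⟩
      obtain ⟨t, hct, ht⟩ := hg i hi
      rw [Finset.mem_Icc] at hi
      rw [hcount, ht, Nat.mul_div_cancel _ (by omega)]
      exact hct
    · ext i
      exact (congrArg (· * i) (hcount i)).trans (Nat.div_mul_cancel (hdvd i))

open PowerSeries in
lemma multSeries_le_mul {i : ℕ} (hi : i ≠ 0) (k : ℕ) :
    multSeries i (fun m => k ≤ m) * (1 - X ^ i) = X ^ (k * i) := by
  ext m
  rw [mul_sub, mul_one, map_sub, coeff_mul_X_pow', coeff_X_pow]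
  simp only [multSeries, coeff_mk]
  have h1 : (∃ t, k ≤ t ∧ m = t * i) ↔ (i ≤ m ∧ ∃ t, k ≤ t ∧ m - i = t * i) ∨ m = k * i := by
    constructor
    · rintro ⟨t, ht, rfl⟩
      rcases ht.eq_or_lt with rfl | ht
      · exact Or.inr rfl
      · obtain ⟨s, rfl⟩ := Nat.exists_eq_add_of_lt ht
        refine Or.inl ⟨Nat.le_mul_of_pos_left _ (by omega), k + s, by omega, ?_⟩
        rw [Nat.add_mul (k + s), one_mul, Nat.add_sub_cancel]
    · rintro (⟨h, t, ht, h'⟩ | rfl)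
      · refine ⟨t + 1, by omega, ?_⟩
        rw [Nat.add_mul, one_mul, ← h', Nat.sub_add_cancel h]
      · exact ⟨k, le_rfl, rfl⟩
  have h2 : m = k * i → ¬ (i ≤ m ∧ ∃ t, k ≤ t ∧ m - i = t * i) := by
    rintro rfl ⟨h, t, ht, h'⟩
    have := Nat.mul_le_mul_right i ht
    omega
  by_cases ha : i ≤ m ∧ ∃ t, k ≤ t ∧ m - i = t * i
  · rw [if_pos (h1.2 (Or.inl ha)), if_pos ha.1, if_pos ha.2, if_neg fun h => h2 h ha, sub_self]
  · by_cases hb : m = k * i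
    · rw [if_pos (h1.2 (Or.inr hb)), if_pos hb]
      split_ifs with h3 h4
      · exact absurd ⟨h3, h4⟩ ha
      · simp
      · simp
    · rw [if_neg fun h => (h1.1 h).elim ha hb, if_neg hb]
      split_ifs with h3 h4
      · exact absurd ⟨h3, h4⟩ ha
      · simp
      · simp

lemma multSeries_eq_zero (i : ℕ) : multSeries i (fun m => m = 0) = 1 := by
  ext m
  simp [multSeries, PowerSeries.coeff_one]

open PowerSeries in
lemma multSeries_le_one {i : ℕ} (hi : i ≠ 0) : multSeries i (fun m => m ≤ 1) = 1 + X ^ i := by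
  ext m
  simp only [multSeries, coeff_mk, map_add, coeff_one, coeff_X_pow]
  have h : (∃ t, t ≤ 1 ∧ m = t * i) ↔ m = 0 ∨ m = i := by
    constructor
    · rintro ⟨t, ht, rfl⟩
      interval_cases t <;> simp
    · rintro (rfl | rfl)
      · exact ⟨0, by simp⟩
      · exact ⟨1, by simp⟩
  simp only [h]
  by_cases h0 : m = 0
  · simp [h0, hi.symm]
  · simp [h0]

/-! ### The two partition classes as multiplicity conditions. -/

/-- The multiplicities allowed by `IsA1` when the largest repeated even part is `2 * j`. -/
def multA₁ (j i m : ℕ) : Prop :=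
  if Even i ∧ i ≤ 2 * j then 2 ≤ m else if i < 2 * j + 2 then m = 0 else m ≤ 1

/-- The multiplicities allowed in partitions counted by `C_{3,1}`. -/
def multC (i m : ℕ) : Prop :=
  if i % 7 = 0 ∨ i % 7 = 1 ∨ i % 7 = 6 then m = 0 else 0 ≤ m

lemma le_largestRepeatedEven {n : ℕ} (p : n.Partition) {a : ℕ} (ha : Even a)
    (h : 2 ≤ partMult p a) : a ≤ largestRepeatedEven p := by
  refine Finset.le_sup (f := id) ?_
  rw [Finset.mem_filter, Multiset.mem_toFinset, ← Multiset.count_pos]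
  exact ⟨by unfold partMult at h; omega, ha, h⟩

lemma largestRepeatedEven_spec {n : ℕ} (p : n.Partition) (h : largestRepeatedEven p ≠ 0) :
    largestRepeatedEven p ∈ p.parts ∧ Even (largestRepeatedEven p) ∧
      2 ≤ partMult p (largestRepeatedEven p) := by
  have hne : (p.parts.toFinset.filter fun a => Even a ∧ 2 ≤ partMult p a).Nonempty := by
    rw [Finset.nonempty_iff_ne_empty]
    intro h'
    exact h (by simp [largestRepeatedEven, h'])
  obtain ⟨a, ha, ha'⟩ := Finset.exists_mem_eq_sup _ hne id
  rw [Finset.mem_filter, Multiset.mem_toFinset] at ha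
  rwa [show largestRepeatedEven p = a from ha']

lemma even_largestRepeatedEven {n : ℕ} (p : n.Partition) : Even (largestRepeatedEven p) := by
  by_cases h : largestRepeatedEven p = 0
  · simp [h]
  · exact (largestRepeatedEven_spec p h).2.1

lemma largestRepeatedEven_le {n : ℕ} (p : n.Partition) : largestRepeatedEven p ≤ n := by
  by_cases h : largestRepeatedEven p = 0
  · simp [h]
  · exact p.le_of_mem_parts (largestRepeatedEven_spec p h).1

/-- Fixing `j` makes the conditions independent for different parts. The bound `2 * j ≤ K` ensures
that every forced repetition is visible in the range. -/
lemma isA1_and_largestRepeatedEven_iff {n K j : ℕ} (hK : n ≤ K) (hj : 2 * j ≤ K)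
    (p : n.Partition) :
    IsA1 p ∧ largestRepeatedEven p = 2 * j ↔
      ∀ i ∈ Finset.Icc 1 K, multA₁ j i (p.parts.count i) := by
  constructor
  · rintro ⟨⟨h1, h2, h3⟩, hL⟩ i hi
    rw [Finset.mem_Icc] at hi
    rw [hL] at h1 h2 h3
    unfold multA₁
    split_ifs with h h'
    · rcases h.2.eq_or_lt with h4 | h4
      · have := (largestRepeatedEven_spec p (by omega)).2.2
        rwa [hL, ← h4] at this
      · exact h1 i h4 (by omega) h.1
    · rw [Multiset.count_eq_zero]
      intro hm
      refine h2 i hm ?_ h'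
      rw [← Nat.not_even_iff_odd]
      rintro ⟨t, rfl⟩
      exact h ⟨⟨t, rfl⟩, by omega⟩
    · by_cases hm : i ∈ p.parts
      · have := h3 i hm (by omega)
        unfold partMult at this
        omega
      · rw [Multiset.count_eq_zero_of_notMem hm]; omega
  · intro h
    have hmem : ∀ a ∈ p.parts, a ∈ Finset.Icc 1 K := fun a ha =>
      Finset.mem_Icc.2 ⟨p.parts_pos ha, (p.le_of_mem_parts ha).trans hK⟩
    have hbig : ∀ a ∈ p.parts, 2 * j < a → ¬ 2 ≤ partMult p a := fun a ha hlt h2 => by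
      have h3 := h a (hmem a ha)
      unfold multA₁ at h3
      unfold partMult at h2
      rw [if_neg (by omega)] at h3
      split_ifs at h3 <;> omega
    have hsmall : ∀ a, 0 < a → Even a → a ≤ 2 * j → 2 ≤ partMult p a := fun a ha he hle => by
      have h3 := h a (Finset.mem_Icc.2 ⟨ha, hle.trans hj⟩)
      unfold multA₁ at h3
      rwa [if_pos ⟨he, hle⟩] at h3
    have hL : largestRepeatedEven p = 2 * j := by
      apply le_antisymm
      · by_contra hlt
        obtain ⟨h4, -, h5⟩ := largestRepeatedEven_spec p (by omega)
        exact hbig _ h4 (by omega) h5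
      · rcases Nat.eq_zero_or_pos j with rfl | hj0
        · simp
        · exact le_largestRepeatedEven p (even_two_mul j)
            (hsmall _ (by omega) (even_two_mul j) le_rfl)
    refine ⟨⟨?_, ?_, ?_⟩, hL⟩ <;> rw [hL]
    · exact fun a ha ha0 he => hsmall a ha0 he ha.le
    · intro a ha ho hlt
      have h3 := h a (hmem a ha)
      unfold multA₁ at h3
      rw [if_neg fun h => (Nat.not_even_iff_odd.2 ho) h.1, if_pos hlt,
        Multiset.count_eq_zero] at h3
      exact h3 ha
    · exact hbig

lemma countA₁_eq_sum_coeff {n K : ℕ} (hK : 2 * n ≤ K) :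
    (countA₁ n : ℤ) = ∑ j ∈ Finset.range (n + 1),
      PowerSeries.coeff n (∏ i ∈ Finset.Icc 1 K, multSeries i (multA₁ j i)) := by
  classical
  have h := Finset.card_eq_sum_card_fiberwise
    (s := Finset.univ.filter fun p : n.Partition => IsA1 p) (t := Finset.range (n + 1))
    (f := fun p => largestRepeatedEven p / 2) fun p _ => by
      have := largestRepeatedEven_le p
      simp only [Finset.coe_range, Set.mem_Iio]
      omega
  rw [countA₁, h, Nat.cast_sum]
  refine Finset.sum_congr rfl fun j hj => ?_
  rw [Finset.mem_range] at hj
  rw [← card_partition_eq_coeff_prod (by omega), Finset.filter_filter]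
  congr 1
  refine congrArg Finset.card ?_
  ext p
  simp only [Finset.mem_filter, Finset.mem_univ, true_and]
  rw [← isA1_and_largestRepeatedEven_iff (by omega) (by omega)]
  have := Nat.two_mul_div_two_of_even (even_largestRepeatedEven p)
  refine and_congr_right fun _ => ?_
  omega

lemma countC_eq_coeff {n K : ℕ} (hK : n ≤ K) :
    (countC 3 1 n : ℤ)
      = PowerSeries.coeff n (∏ i ∈ Finset.Icc 1 K, multSeries i (multC i)) := by
  classical
  rw [← card_partition_eq_coeff_prod hK, countC]
  congr 1
  refine congrArg Finset.card ?_
  ext p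
  simp only [Finset.mem_filter, Finset.mem_univ, true_and]
  have key : ∀ a : ℕ, (¬ (a : ℤ) ≡ 0 [ZMOD 2 * (3 : ℕ) + 1] ∧
      ¬ (a : ℤ) ≡ (1 : ℕ) [ZMOD 2 * (3 : ℕ) + 1] ∧
      ¬ (a : ℤ) ≡ -(1 : ℕ) [ZMOD 2 * (3 : ℕ) + 1]) ↔
      ¬ (a % 7 = 0 ∨ a % 7 = 1 ∨ a % 7 = 6) := fun a => by
    simp only [Int.ModEq]; omega
  constructor
  · intro h i _
    unfold multC
    split_ifs with h7
    · rw [Multiset.count_eq_zero]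
      exact fun hi => (key i).1 (h i hi) h7
    · exact Nat.zero_le _
  · intro h a ha
    rw [key]
    intro h7
    have h3 := h a (Finset.mem_Icc.2 ⟨p.parts_pos ha, (p.le_of_mem_parts ha).trans hK⟩)
    unfold multC at h3
    rw [if_pos h7, Multiset.count_eq_zero] at h3
    exact h3 ha

/-! ### Factors and products after multiplication by the Euler product. -/

-- The base `X²` arises because `(1 + X^i)(1 - X^i) = 1 - X^(2i)` and a part repeated at least twice
-- contributes `X^(2i)`.
open PowerSeries in
lemma multSeries_multA₁_mul {i : ℕ} (hi : i ≠ 0) (j : ℕ) :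
    multSeries i (multA₁ j i) * (1 - X ^ i) =
      if i < 2 * j + 2 then (if Even i then (X ^ 2) ^ i else 1 - X ^ i)
      else 1 - (X ^ 2) ^ i := by
  have hX : ((X : ℤ⟦X⟧) ^ 2) ^ i = X ^ (2 * i) := (pow_mul _ _ _).symm
  by_cases h1 : Even i ∧ i ≤ 2 * j
  · rw [show multA₁ j i = fun m => 2 ≤ m from funext fun m => if_pos h1, multSeries_le_mul hi,
      if_pos (by omega), if_pos h1.1, hX]
  by_cases h2 : i < 2 * j + 2
  · rw [show multA₁ j i = fun m => m = 0 from funext fun m => (if_neg h1).trans (if_pos h2),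
      multSeries_eq_zero, if_pos h2, if_neg fun he => h1 ⟨he, ?_⟩, one_mul]
    obtain ⟨t, rfl⟩ := he
    omega
  · rw [show multA₁ j i = fun m => m ≤ 1 from funext fun m => (if_neg h1).trans (if_neg h2),
      multSeries_le_one hi, if_neg h2, hX, two_mul, pow_add]
    ring

open PowerSeries in
lemma multSeries_multC_mul {i : ℕ} (hi : i ≠ 0) :
    multSeries i (multC i) * (1 - X ^ i) =
      if i % 7 = 0 ∨ i % 7 = 1 ∨ i % 7 = 6 then 1 - X ^ i else 1 := by
  by_cases h : i % 7 = 0 ∨ i % 7 = 1 ∨ i % 7 = 6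
  · rw [show multC i = fun m => m = 0 from funext fun m => if_pos h, multSeries_eq_zero,
      if_pos h, one_mul]
  · rw [show multC i = fun m => 0 ≤ m from funext fun m => if_neg h, multSeries_le_mul hi,
      if_neg h, zero_mul, pow_zero]

section Product

variable {R : Type*} [CommRing R]

lemma prod_Ico_parity (q : R) (j : ℕ) :
    ∏ i ∈ Finset.Ico 1 (2 * j + 2), (if Even i then (q ^ 2) ^ i else 1 - q ^ i)
      = (q ^ 2) ^ (j ^ 2 + j) * ∏ k ∈ Finset.range (j + 1), (1 - q ^ (2 * k + 1)) := by
  induction j with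
  | zero => simp
  | succ j ih =>
    rw [show 2 * (j + 1) + 2 = 2 * j + 2 + 1 + 1 by ring, Finset.prod_Ico_succ_top (by omega),
      Finset.prod_Ico_succ_top (by omega), ih, Finset.prod_range_succ _ (j + 1),
      if_pos (by simp [parity_simps]), if_neg (by simp [parity_simps]),
      show (j + 1) ^ 2 + (j + 1) = (j ^ 2 + j) + (2 * j + 2) by ring, pow_add (q ^ 2) (j ^ 2 + j),
      show 2 * (j + 1) + 1 = 2 * j + 2 + 1 by ring]
    ring

lemma prod_Ico_mod_seven (q : R) (N : ℕ) :
    ∏ i ∈ Finset.Ico 1 (7 * N + 1),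
      (if i % 7 = 0 ∨ i % 7 = 1 ∨ i % 7 = 6 then 1 - q ^ i else 1)
      = ∏ k ∈ Finset.range N,
        (1 - q ^ (7 * k + 1)) * (1 - q ^ (7 * k + 6)) * (1 - q ^ (7 * k + 7)) := by
  induction N with
  | zero => simp
  | succ N ih =>
    rw [show 7 * (N + 1) + 1 = 7 * N + 1 + 1 + 1 + 1 + 1 + 1 + 1 + 1 by ring]
    iterate 7 rw [Finset.prod_Ico_succ_top (by omega)]
    rw [ih, Finset.prod_range_succ, if_pos (by omega), if_neg (by omega), if_neg (by omega),
      if_neg (by omega), if_neg (by omega), if_pos (by omega), if_pos (by omega)]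
    simp only [mul_one]
    ring

/-- The factors from `2j + 2` onwards form the tail `(q²;q²)_∞ / (q²;q²)_{2j+1}`, and the earlier
ones are given by `prod_Ico_parity`. -/
lemma prod_Ico_multA₁ {q : R} {N j K : ℕ} (hq : q ^ N = 0) (hK : N ≤ K)
    (hj : 2 * j + 1 ≤ K) :
    ∏ i ∈ Finset.Ico 1 (K + 1),
      (if i < 2 * j + 2 then (if Even i then (q ^ 2) ^ i else 1 - q ^ i) else 1 - (q ^ 2) ^ i)
      = (q ^ 2) ^ (j ^ 2 + j) * (∏ k ∈ Finset.range (j + 1), (1 - q ^ (2 * k + 1))) *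
        qPochInv (q ^ 2) (2 * j + 1) * qPoch (q ^ 2) N := by
  have hQ : (q ^ 2) ^ N = 0 := by rw [← pow_mul, mul_comm, pow_mul, hq, zero_pow two_ne_zero]
  rw [← Finset.prod_Ico_consecutive _ (show 1 ≤ 2 * j + 2 by omega) (by omega),
    ← prod_Ico_parity, mul_assoc]
  congr 1
  · refine Finset.prod_congr rfl fun i hi => ?_
    rw [Finset.mem_Ico] at hi
    rw [if_pos hi.2]
  · have h1 : ∏ i ∈ Finset.Ico (2 * j + 2) (K + 1),
        (if i < 2 * j + 2 then (if Even i then (q ^ 2) ^ i else 1 - q ^ i)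
          else 1 - (q ^ 2) ^ i)
        = ∏ i ∈ Finset.Ico (2 * j + 1 + 1) (K + 1), (1 - (q ^ 2) ^ i) := by
      refine Finset.prod_congr rfl fun i hi => ?_
      rw [Finset.mem_Ico] at hi
      rw [if_neg (by omega)]
    have h2 := qPoch_mul_prod_Ico (q ^ 2) hj
    rw [qPoch_eq_of_le hQ hK] at h2
    have h3 := qPoch_mul_qPochInv ⟨N, hQ⟩ (2 * j + 1)
    rw [h1]
    linear_combination qPochInv (q ^ 2) (2 * j + 1) * h2 -
      (∏ i ∈ Finset.Ico (2 * j + 1 + 1) (K + 1), (1 - (q ^ 2) ^ i)) * h3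

end Product

/-! ### The identity modulo `X^N` and the conclusion. -/

open PowerSeries in
/-- The Rogers–Selberg identity for the product with factors `≡ 0, ±1 (mod 7)` removed, modulo a
power of `X`. -/
theorem rogers_selberg_modEq (N : ℕ) :
    (X : ℤ⟦X⟧) ^ N ∣
      (∑ j ∈ Finset.range N, ∏ i ∈ Finset.Icc 1 (7 * N), multSeries i (multA₁ j i)) -
        ∏ i ∈ Finset.Icc 1 (7 * N), multSeries i (multC i) := by
  rw [← Ideal.mem_span_singleton, ← Ideal.Quotient.eq]
  set φ := Ideal.Quotient.mk (Ideal.span {(X : ℤ⟦X⟧) ^ N})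
  have hq : φ X ^ N = 0 := by
    rw [← map_pow, Ideal.Quotient.eq_zero_iff_mem]
    exact Ideal.mem_span_singleton_self _
  -- The truncated Euler product is a unit in the quotient, so both sides may be multiplied by it.
  -- The cutoff `7 * N` gives complete blocks of residues modulo seven.
  have hE : IsUnit (φ (∏ i ∈ Finset.Icc 1 (7 * N), (1 - X ^ i))) := by
    rw [map_prod]
    refine Finset.prod_induction _ _ (fun _ _ => IsUnit.mul) isUnit_one fun i hi => ?_
    rw [Finset.mem_Icc] at hi
    rw [map_sub, map_one, map_pow]
    exact isUnit_one_sub_pow ⟨N, hq⟩ (by omega)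
  have hI : Finset.Icc 1 (7 * N) = Finset.Ico 1 (7 * N + 1) := by
    ext i; rw [Finset.mem_Icc, Finset.mem_Ico]; omega
  have hne : ∀ i ∈ Finset.Ico 1 (7 * N + 1), i ≠ 0 := fun i hi => by
    rw [Finset.mem_Ico] at hi; omega
  rw [← hE.mul_left_inj, ← map_mul, ← map_mul, Finset.sum_mul, map_sum, hI]
  have hC : φ ((∏ i ∈ Finset.Ico 1 (7 * N + 1), multSeries i (multC i)) *
      ∏ i ∈ Finset.Ico 1 (7 * N + 1), (1 - X ^ i)) =
      ∑ r ∈ Finset.Ico (-N : ℤ) N, ((r.negOnePow : ℤ) : _) * φ X ^ quadExp 7 5 r := by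
    rw [theta_eq_prod hq, ← prod_Ico_mod_seven, ← Finset.prod_mul_distrib, map_prod]
    refine Finset.prod_congr rfl fun i hi => ?_
    rw [multSeries_multC_mul (hne i hi), apply_ite φ, map_sub, map_one, map_pow]
  rw [hC, ← sum_bailey_eq_theta hq]
  refine Finset.sum_congr rfl fun j hj => ?_
  rw [Finset.mem_range] at hj
  rw [← prod_Ico_multA₁ (K := 7 * N) hq (by omega) (by omega), ← Finset.prod_mul_distrib,
    map_prod]
  refine Finset.prod_congr rfl fun i hi => ?_
  rw [multSeries_multA₁_mul (hne i hi), apply_ite φ, apply_ite φ, map_sub, map_sub, map_one,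
    map_pow, map_pow, map_pow]

theorem mainTheorem5 (n : ℕ) : countA₁ n = countC 3 1 n := by
  have h := PowerSeries.X_pow_dvd_iff.1 (rogers_selberg_modEq (n + 1)) n (Nat.lt_succ_self n)
  rw [map_sub, map_sum, ← countA₁_eq_sum_coeff (by omega), ← countC_eq_coeff (by omega),
    sub_eq_zero] at h
  exact_mod_cast h
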